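/- Let $F$ be a non-empty finite set of primes and let $q\notin F$ be a prime. For $\mathbf l=(l_p)\in\mathbb N^F$ (where $0\in\mathbb N$) let $o_{\mathbf l}(q)$ denote the order of $q$ in the finite group $\prod_{p\in F}\mathcal U(\mathbb Z/p^{l_p}\mathbb Z)$, where $\mathcal U(R)$ is the group of units of a ring $R$. Let $\mathbb Z_F=\prod_{p\in F}\mathbb Z_p$, let $\sigma$ be the action of $\mathbb Z$ on $C(\mathcal U(\mathbb Z_F))$ given by $\sigma_m(f)(x)=f(q^{-m}x)$, and let $C(\mathcal U(\mathbb Z_F))\rtimes_\sigma\mathbb Z$ be the (universal) crossed product $C^*$-algebra. For a sequence of integers $n_k\ge 2$ $(k\ge 0)$, a Bunce–Deddens algebra with supernatural number $\prod_{k\ge0} n_k$ is a $C^*$-algebra isomorphic to the crossed product $C(X)\rtimes_\tau\mathbb Z$, where $X=\prod_{k\ge 0}\{0,1,\dots,n_k-1\}$ and $\tau$ is induced by the odometer on $X$, that is, by addition of $1$ with carry over. Then there are $\mathbf K=(K_p)\in\mathbb N^F$ with all $K_p\ge1$ and a positive integer $d$ such that $$o_{\mathbf K+\mathbf l}(q)=d\prod_{p\in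 F}p^{l_p}\qquad\text{for every }\mathbf l\in\mathbb N^F,$$ $d$ divides $\prod_{p\in F}(p-1)p^{K_p-1}$, and $C(\mathcal U(\mathbb Z_F))\rtimes_\sigma\mathbb Z$ is isomorphic to the direct sum of $\bigl(\prod_{p\in F}(p-1)p^{K_p-1}\bigr)/d$ copies of a single Bunce–Deddens algebra with supernatural number $d\prod_{p\in F}p^{\infty}$. -/

import Mathlib

noncomputable section

namespace CStarDynamics

open UniformSpace

/-! ### The crossed product of a unital C*-algebra by a discrete group -/

section CrossedProduct

variable {G A : Type*} [Group G] [CStarAlgebra A]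

/-- The dense *-algebra `C_c(G, A)` of a C*-dynamical system `(A, G, ρ)` with `G` discrete:
finitely supported functions `G → A`, with `single g a` playing the role of `a u_g`,
the product `(a u_g) (b u_h) = a ρ_g(b) u_{gh}`
and the involution `(a u_g)* = ρ_{g⁻¹}(a*) u_{g⁻¹}`. -/
def CovAlg (_ρ : G →* (A ≃⋆ₐ[ℂ] A)) : Type _ := SkewMonoidAlgebra A G

namespace CovAlg

variable (ρ : G →* (A ≃⋆ₐ[ℂ] A))

/-- The group action of `G` on `A` given by `ρ`. -/
@[reducible] def action : MulSemiringAction G A where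
  smul g a := ρ g a
  one_smul a := by change ρ 1 a = a; simp
  mul_smul g h a := by change ρ (g * h) a = ρ g (ρ h a); simp
  smul_zero g := map_zero (ρ g)
  smul_add g := map_add (ρ g)
  smul_one g := map_one (ρ g)
  smul_mul g := map_mul (ρ g)

instance instRing : Ring (CovAlg ρ) :=
  letI := action ρ
  inferInstanceAs (Ring (SkewMonoidAlgebra A G))

instance instAlgebra : Algebra ℂ (CovAlg ρ) :=
  letI := action ρ
  haveI : SMulCommClass G ℂ A := ⟨fun g c a => map_smul (ρ g) c a⟩
  (inferInstance : Algebra ℂ (SkewMonoidAlgebra A G))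

/-- The element `a u_g`. -/
def single (g : G) (a : A) : CovAlg ρ := SkewMonoidAlgebra.single g a

variable {ρ}

theorem single_add (g : G) (a b : A) : single ρ g (a + b) = single ρ g a + single ρ g b :=
  SkewMonoidAlgebra.single_add g a b

theorem single_zero (g : G) : single ρ g 0 = 0 :=
  SkewMonoidAlgebra.single_zero g

theorem single_mul_single (g h : G) (a b : A) :
    single ρ g a * single ρ h b = single ρ (g * h) (a * ρ g b) :=
  letI := action ρ
  SkewMonoidAlgebra.single_mul_single

theorem smul_single (c : ℂ) (g : G) (a : A) : c • single ρ g a = single ρ g (c • a) :=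
  SkewMonoidAlgebra.smul_single c g a

theorem one_def : (1 : CovAlg ρ) = single ρ 1 1 := rfl

theorem induction {P : CovAlg ρ → Prop} (x : CovAlg ρ) (zero : P 0)
    (single : ∀ g a, P (single ρ g a)) (add : ∀ x y, P x → P y → P (x + y)) : P x :=
  SkewMonoidAlgebra.induction_on (p := P) x zero single add

/-- The additive map out of `C_c(G, A)` with prescribed values on the elements `a u_g`. -/
def liftAdd {M : Type*} [AddCommMonoid M] (f : G → A →+ M) : CovAlg ρ →+ M where
  toFun x := SkewMonoidAlgebra.sum x fun g a => f g a
  map_zero' := SkewMonoidAlgebra.sum_zero_index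
  map_add' _ _ := SkewMonoidAlgebra.sum_add_index' (fun g => map_zero (f g))
    (fun g => map_add (f g))

theorem liftAdd_single {M : Type*} [AddCommMonoid M] (f : G → A →+ M) (g : G) (a : A) :
    liftAdd f (single ρ g a) = f g a :=
  SkewMonoidAlgebra.sum_single_index (map_zero (f g))

/-- The involution of `C_c(G, A)`. -/
def starAdd : CovAlg ρ →+ CovAlg ρ :=
  liftAdd fun g =>
    { toFun := fun a => single ρ g⁻¹ (ρ g⁻¹ (star a))
      map_zero' := by simp [single_zero]
      map_add' := fun a b => by simp [single_add] }

instance instStar : Star (CovAlg ρ) := ⟨starAdd⟩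

theorem star_single (g : G) (a : A) :
    star (single ρ g a) = single ρ g⁻¹ (ρ g⁻¹ (star a)) :=
  liftAdd_single _ g a

theorem star_add' (x y : CovAlg ρ) : star (x + y) = star x + star y := map_add starAdd x y

theorem star_zero' : star (0 : CovAlg ρ) = 0 := map_zero starAdd

theorem apply_inv_apply (g : G) (a : A) : ρ g⁻¹ (ρ g a) = a := by
  rw [← StarAlgEquiv.mul_apply, ← map_mul]; simp

theorem apply_apply_inv (g : G) (a : A) : ρ g (ρ g⁻¹ a) = a := by
  rw [← StarAlgEquiv.mul_apply, ← map_mul]; simp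

instance instStarRing : StarRing (CovAlg ρ) where
  star_involutive x := by
    induction x using induction with
    | zero => simp [star_zero']
    | single g a =>
      rw [star_single, star_single, ← map_star, star_star, inv_inv, apply_apply_inv]
    | add x y hx hy => rw [star_add', star_add', hx, hy]
  star_add := star_add'
  star_mul x y := by
    induction x using induction with
    | zero => simp [star_zero']
    | add x x' hx hx' => rw [add_mul, star_add', hx, hx', star_add', mul_add]
    | single g a =>
      induction y using induction with
      | zero => simp [star_zero']
      | add y y' hy hy' => rw [mul_add, star_add', hy, hy', star_add', add_mul]
      | single h b =>
        rw [single_mul_single, star_single, star_single, star_single, single_mul_single,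
          mul_inv_rev, star_mul, map_mul]
        simp only [map_mul, StarAlgEquiv.mul_apply, ← map_star, apply_inv_apply]

instance instStarModule : StarModule ℂ (CovAlg ρ) where
  star_smul c x := by
    induction x using induction with
    | zero => simp
    | add x y hx hy => rw [smul_add, star_add, hx, hy, star_add, smul_add]
    | single g a => rw [smul_single, star_single, star_single, smul_single, star_smul, map_smul]

/-- The C*-seminorms on `C_c(G, A)` with `p (a u_g) ≤ ‖a‖`. They are exactly the functions
`x ↦ ‖π x‖` for *-homomorphisms `π` from `C_c(G, A)` to C*-algebras that restrict to
contractions on the copy of `A`, that is, the seminorms of covariant representations. -/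
structure IsCStarSeminorm (p : Seminorm ℂ (CovAlg ρ)) : Prop where
  mul_le : ∀ x y, p (x * y) ≤ p x * p y
  star_mul_self : ∀ x, p (star x * x) = p x ^ 2
  single_le : ∀ g a, p (single ρ g a) ≤ ‖a‖

theorem IsCStarSeminorm.zero : IsCStarSeminorm (0 : Seminorm ℂ (CovAlg ρ)) :=
  ⟨by simp, by simp, by simp⟩

instance : Nonempty {p : Seminorm ℂ (CovAlg ρ) // IsCStarSeminorm p} :=
  ⟨⟨0, IsCStarSeminorm.zero⟩⟩

/-- The maximal C*-seminorm on `C_c(G, A)`. -/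
def maxNorm (x : CovAlg ρ) : ℝ := ⨆ p : {p : Seminorm ℂ (CovAlg ρ) // IsCStarSeminorm p}, p.1 x

theorem exists_bound (x : CovAlg ρ) :
    ∃ C, ∀ p : {p : Seminorm ℂ (CovAlg ρ) // IsCStarSeminorm p}, p.1 x ≤ C := by
  induction x using induction with
  | zero => exact ⟨0, fun p => by simp⟩
  | single g a => exact ⟨‖a‖, fun p => p.2.single_le g a⟩
  | add x y hx hy =>
    obtain ⟨C, hC⟩ := hx
    obtain ⟨D, hD⟩ := hy
    exact ⟨C + D, fun p => (map_add_le_add p.1 x y).trans (add_le_add (hC p) (hD p))⟩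

theorem le_maxNorm {p : Seminorm ℂ (CovAlg ρ)} (hp : IsCStarSeminorm p) (x : CovAlg ρ) :
    p x ≤ maxNorm x := by
  obtain ⟨C, hC⟩ := exists_bound x
  exact le_ciSup (f := fun p : {p : Seminorm ℂ (CovAlg ρ) // IsCStarSeminorm p} => p.1 x)
    ⟨C, by rintro _ ⟨p, rfl⟩; exact hC p⟩ ⟨p, hp⟩

theorem maxNorm_le {x : CovAlg ρ} {C : ℝ}
    (h : ∀ p : Seminorm ℂ (CovAlg ρ), IsCStarSeminorm p → p x ≤ C) : maxNorm x ≤ C :=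
  ciSup_le fun p => h p.1 p.2

theorem maxNorm_nonneg (x : CovAlg ρ) : 0 ≤ maxNorm x :=
  le_maxNorm IsCStarSeminorm.zero x

theorem IsCStarSeminorm.star_eq {p : Seminorm ℂ (CovAlg ρ)} (hp : IsCStarSeminorm p)
    (x : CovAlg ρ) : p (star x) = p x := by
  have key : ∀ y, p y ≤ p (star y) := fun y => by
    rcases (apply_nonneg p y).eq_or_lt with h | h
    · rw [← h]; exact apply_nonneg p _
    · have := hp.mul_le (star y) y
      rw [hp.star_mul_self, sq] at this
      exact le_of_mul_le_mul_right this h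
  exact le_antisymm (by simpa using key (star x)) (key x)

theorem maxNorm_add (x y : CovAlg ρ) : maxNorm (x + y) ≤ maxNorm x + maxNorm y :=
  maxNorm_le fun p hp => (map_add_le_add p x y).trans
    (add_le_add (le_maxNorm hp x) (le_maxNorm hp y))

theorem maxNorm_mul (x y : CovAlg ρ) : maxNorm (x * y) ≤ maxNorm x * maxNorm y :=
  maxNorm_le fun p hp => (hp.mul_le x y).trans
    (mul_le_mul (le_maxNorm hp x) (le_maxNorm hp y) (apply_nonneg p y) (maxNorm_nonneg x))

theorem maxNorm_star (x : CovAlg ρ) : maxNorm (star x) = maxNorm x := by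
  have key : ∀ y : CovAlg ρ, maxNorm (star y) ≤ maxNorm y := fun y =>
    maxNorm_le fun p hp => by rw [hp.star_eq]; exact le_maxNorm hp y
  exact le_antisymm (key x) (by simpa using key (star x))

theorem sq_maxNorm_le (x : CovAlg ρ) : maxNorm x ^ 2 ≤ maxNorm (star x * x) := by
  have h : maxNorm x ≤ √(maxNorm (star x * x)) := maxNorm_le fun p hp => by
    refine Real.le_sqrt_of_sq_le ?_
    rw [← hp.star_mul_self]
    exact le_maxNorm hp _
  calc maxNorm x ^ 2 ≤ √(maxNorm (star x * x)) ^ 2 := by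
        gcongr; exact maxNorm_nonneg x
    _ = _ := Real.sq_sqrt (maxNorm_nonneg _)

theorem maxNorm_smul_le (c : ℂ) (x : CovAlg ρ) : maxNorm (c • x) ≤ ‖c‖ * maxNorm x :=
  maxNorm_le fun p hp => by
    rw [map_smul_eq_mul]
    exact mul_le_mul_of_nonneg_left (le_maxNorm hp x) (norm_nonneg c)

/-- `maxNorm` as a bundled ring seminorm. -/
def maxRingSeminorm : RingSeminorm (CovAlg ρ) where
  toFun := maxNorm
  map_zero' := le_antisymm (maxNorm_le fun p _ => by simp) (maxNorm_nonneg 0)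
  add_le' := maxNorm_add
  neg' x := by simp [maxNorm]
  mul_le' := maxNorm_mul

instance instSeminormedRing : SeminormedRing (CovAlg ρ) :=
  { maxRingSeminorm.toSeminormedRing with }

theorem norm_def (x : CovAlg ρ) : ‖x‖ = maxNorm x := rfl

instance instNormedAlgebra : NormedAlgebra ℂ (CovAlg ρ) where
  norm_smul_le := maxNorm_smul_le

theorem isometry_star : Isometry (star : CovAlg ρ → CovAlg ρ) :=
  AddMonoidHomClass.isometry_of_norm (starAdd (ρ := ρ)) maxNorm_star

end CovAlg

/-- The (full) crossed product `A ⋊_ρ G`: the Hausdorff completion of `C_c(G, A)` in its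
maximal C*-seminorm. -/
def CrossedProduct (ρ : G →* (A ≃⋆ₐ[ℂ] A)) : Type _ := Completion (CovAlg ρ)

namespace CrossedProduct

variable {ρ : G →* (A ≃⋆ₐ[ℂ] A)}

instance instNormedRing : NormedRing (CrossedProduct ρ) :=
  inferInstanceAs (NormedRing (Completion (CovAlg ρ)))

instance instAlgebra : Algebra ℂ (CrossedProduct ρ) :=
  inferInstanceAs (Algebra ℂ (Completion (CovAlg ρ)))

instance instNormedAlgebra : NormedAlgebra ℂ (CrossedProduct ρ) where
  norm_smul_le c x := norm_smul_le c (show Completion (CovAlg ρ) from x)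

instance instCompleteSpace : CompleteSpace (CrossedProduct ρ) :=
  inferInstanceAs (CompleteSpace (Completion (CovAlg ρ)))

/-- The canonical map from `C_c(G, A)` to the crossed product. -/
def of (x : CovAlg ρ) : CrossedProduct ρ := (x : Completion (CovAlg ρ))

theorem of_add (x y : CovAlg ρ) : of (x + y) = of x + of y := Completion.coe_add x y

theorem of_mul (x y : CovAlg ρ) : of (x * y) = of x * of y := Completion.coe_mul x y

theorem of_one : of (1 : CovAlg ρ) = 1 := rfl

theorem of_zero : of (0 : CovAlg ρ) = 0 := rfl

theorem of_smul (c : ℂ) (x : CovAlg ρ) : of (c • x) = c • of x := Completion.coe_smul c x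

theorem norm_of (x : CovAlg ρ) : ‖of x‖ = CovAlg.maxNorm x := Completion.norm_coe x

theorem continuous_of : Continuous (of : CovAlg ρ → CrossedProduct ρ) :=
  Completion.continuous_coe _

theorem induction {P : CrossedProduct ρ → Prop} (x : CrossedProduct ρ)
    (hP : IsClosed {x | P x}) (h : ∀ x, P (of x)) : P x :=
  Completion.induction_on x hP h

instance instStar : Star (CrossedProduct ρ) :=
  ⟨Completion.map (star : CovAlg ρ → CovAlg ρ)⟩

theorem star_of (x : CovAlg ρ) : star (of x) = of (star x) :=
  Completion.map_coe CovAlg.isometry_star.uniformContinuous x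

theorem continuous_star' : Continuous (star : CrossedProduct ρ → CrossedProduct ρ) :=
  Completion.continuous_map

instance instStarRing : StarRing (CrossedProduct ρ) where
  star_involutive x := by
    induction x using induction with
    | hP => exact isClosed_eq (continuous_star'.comp continuous_star') continuous_id
    | h x => rw [star_of, star_of, star_star]
  star_add x y := by
    induction x using induction with
    | hP => exact isClosed_eq (continuous_star'.comp (by fun_prop))
              (continuous_star'.add continuous_const)
    | h x =>
      induction y using induction with
      | hP => exact isClosed_eq (continuous_star'.comp (by fun_prop))
                (continuous_const.add continuous_star')
      | h y => rw [← of_add, star_of, star_of, star_of, star_add, of_add]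
  star_mul x y := by
    induction x using induction with
    | hP => exact isClosed_eq (continuous_star'.comp (by fun_prop))
              (continuous_const.mul continuous_star')
    | h x =>
      induction y using induction with
      | hP => exact isClosed_eq (continuous_star'.comp (by fun_prop))
                (continuous_star'.mul continuous_const)
      | h y => rw [← of_mul, star_of, star_of, star_of, star_mul, of_mul]

instance instCStarRing : CStarRing (CrossedProduct ρ) where
  norm_mul_self_le x := by
    induction x using induction with
    | hP => exact isClosed_le (by fun_prop) ((continuous_star'.mul continuous_id).norm)
    | h x =>
      rw [star_of, ← of_mul, norm_of, norm_of, ← sq]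
      exact CovAlg.sq_maxNorm_le x

instance instStarModule : StarModule ℂ (CrossedProduct ρ) where
  star_smul c x := by
    induction x using induction with
    | hP => exact isClosed_eq (continuous_star'.comp (continuous_const_smul c))
              ((continuous_const_smul (star c)).comp continuous_star')
    | h x => rw [← of_smul, star_of, star_of, star_smul, of_smul]

instance instCStarAlgebra : CStarAlgebra (CrossedProduct ρ) where

/-- The canonical copy of `A` in the crossed product. -/
def incl (ρ : G →* (A ≃⋆ₐ[ℂ] A)) (a : A) : CrossedProduct ρ := of (CovAlg.single ρ 1 a)

/-- The canonical unitaries in the crossed product. -/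
def unit (ρ : G →* (A ≃⋆ₐ[ℂ] A)) (g : G) : CrossedProduct ρ := of (CovAlg.single ρ g 1)

theorem unit_mul_incl_mul_star_unit (g : G) (a : A) :
    unit ρ g * incl ρ a * star (unit ρ g) = incl ρ (ρ g a) := by
  simp [unit, incl, star_of, CovAlg.star_single, ← of_mul, CovAlg.single_mul_single]

/-- The crossed product is the universal C*-algebra for covariant representations of
`(A, G, ρ)`. -/
theorem existsUnique_lift {B : Type*} [CStarAlgebra B] (φ : A →⋆ₐ[ℂ] B) (u : G →* unitary B)
    (hcov : ∀ g a, φ (ρ g a) = (u g : B) * φ a * star (u g : B)) :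
    ∃! Φ : CrossedProduct ρ →⋆ₐ[ℂ] B, (∀ a, Φ (incl ρ a) = φ a) ∧ ∀ g, Φ (unit ρ g) = u g := by
  have hc : ∀ g a, (u g : B) * φ a = φ (ρ g a) * (u g : B) := fun g a => by
    rw [hcov, mul_assoc, Unitary.coe_star_mul_self, mul_one]
  have hinv : ∀ g, (u g⁻¹ : B) = star (u g : B) := fun g => by
    rw [map_inv]; rfl
  let L : CovAlg ρ →+ B := CovAlg.liftAdd fun g =>
    (AddMonoidHom.mulRight (u g : B)).comp (φ : A →+* B).toAddMonoidHom
  have hL : ∀ g a, L (CovAlg.single ρ g a) = φ a * u g := fun g a => CovAlg.liftAdd_single _ g a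
  have Lmul : ∀ x y, L (x * y) = L x * L y := fun x y => by
    induction x using CovAlg.induction with
    | zero => simp
    | add x x' hx hx' => rw [add_mul, map_add, hx, hx', map_add, add_mul]
    | single g a =>
      induction y using CovAlg.induction with
      | zero => simp
      | add y y' hy hy' => rw [mul_add, map_add, hy, hy', map_add, mul_add]
      | single h b =>
        rw [CovAlg.single_mul_single, hL, hL, hL, map_mul, map_mul, Submonoid.coe_mul,
          mul_assoc (φ a) (u g : B), ← mul_assoc (u g : B), hc]
        simp only [mul_assoc]
  have Lstar : ∀ x, L (star x) = star (L x) := fun x => by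
    induction x using CovAlg.induction with
    | zero => simp
    | add x x' hx hx' => rw [star_add, map_add, hx, hx', map_add, star_add]
    | single g a =>
      rw [CovAlg.star_single, hL, hL, star_mul, ← hinv, ← map_star, hc]
  have Lsmul : ∀ (c : ℂ) x, L (c • x) = c • L x := fun c x => by
    induction x using CovAlg.induction with
    | zero => simp
    | add x x' hx hx' => rw [smul_add, map_add, hx, hx', map_add, smul_add]
    | single g a => rw [CovAlg.smul_single, hL, hL, map_smul, smul_mul_assoc]
  have Lone : L 1 = 1 := by rw [CovAlg.one_def, hL]; simp
  let p : Seminorm ℂ (CovAlg ρ) := Seminorm.of (fun x => ‖L x‖)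
    (fun x y => by simpa using norm_add_le (L x) (L y))
    (fun c x => by rw [Lsmul, norm_smul])
  have hp : CovAlg.IsCStarSeminorm p := by
    refine ⟨fun x y => ?_, fun x => ?_, fun g a => ?_⟩
    · change ‖L (x * y)‖ ≤ ‖L x‖ * ‖L y‖
      rw [Lmul]; exact norm_mul_le _ _
    · change ‖L (star x * x)‖ = ‖L x‖ ^ 2
      rw [Lmul, Lstar, CStarRing.norm_star_mul_self, sq]
    · change ‖L (CovAlg.single ρ g a)‖ ≤ ‖a‖
      rw [hL, CStarRing.norm_mul_coe_unitary]
      exact NonUnitalStarAlgHom.norm_apply_le φ a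
  have Lcont : Continuous L := AddMonoidHomClass.continuous_of_bound L 1 fun x => by
    rw [one_mul]; exact CovAlg.le_maxNorm hp x
  have Luc : UniformContinuous L := uniformContinuous_addMonoidHom_of_continuous Lcont
  let E : CrossedProduct ρ → B := Completion.extension L
  have hE : ∀ x, E (of x) = L x := fun x => Completion.extension_coe Luc x
  have Econt : Continuous E := Completion.continuous_extension
  have Esmul : ∀ (c : ℂ) x, E (c • x) = c • E x := fun c x => by
    induction x using induction with
    | hP => exact isClosed_eq (Econt.comp (continuous_const_smul c))
              ((continuous_const_smul c).comp Econt)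
    | h x => rw [← of_smul, hE, hE, Lsmul]
  have Eone : E 1 = 1 := by rw [← of_one, hE, Lone]
  let Φ : CrossedProduct ρ →⋆ₐ[ℂ] B :=
    { toFun := E
      map_one' := Eone
      map_zero' := by rw [← of_zero, hE, map_zero]
      map_mul' := fun x y => by
        induction x using induction with
        | hP => exact isClosed_eq (Econt.comp (by fun_prop)) (Econt.mul continuous_const)
        | h x =>
          induction y using induction with
          | hP => exact isClosed_eq (Econt.comp (by fun_prop)) (continuous_const.mul Econt)
          | h y => rw [← of_mul, hE, hE, hE, Lmul]
      map_add' := fun x y => by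
        induction x using induction with
        | hP => exact isClosed_eq (Econt.comp (by fun_prop)) (Econt.add continuous_const)
        | h x =>
          induction y using induction with
          | hP => exact isClosed_eq (Econt.comp (by fun_prop)) (continuous_const.add Econt)
          | h y => rw [← of_add, hE, hE, hE, map_add]
      commutes' := fun c => by
        rw [Algebra.algebraMap_eq_smul_one, Algebra.algebraMap_eq_smul_one, Esmul, Eone]
      map_star' := fun x => by
        induction x using induction with
        | hP => exact isClosed_eq (Econt.comp continuous_star') (continuous_star.comp Econt)
        | h x => rw [star_of, hE, hE, Lstar] }
  refine ⟨Φ, ⟨fun a => ?_, fun g => ?_⟩, fun Ψ hΨ => ?_⟩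
  · change E (of _) = _
    rw [hE, hL]; simp
  · change E (of _) = _
    rw [hE, hL]; simp
  · have hΨc : Continuous Ψ :=
      AddMonoidHomClass.continuous_of_bound Ψ 1 fun x => by
        simpa using NonUnitalStarAlgHom.norm_apply_le Ψ x
    ext x
    change Ψ x = E x
    induction x using induction with
    | hP => exact isClosed_eq hΨc Econt
    | h x =>
      rw [hE]
      induction x using CovAlg.induction with
      | zero => rw [of_zero, map_zero, map_zero]
      | add x y hx hy => rw [of_add, map_add, hx, hy, map_add]
      | single g a =>
        have : CovAlg.single ρ g a = CovAlg.single ρ 1 a * CovAlg.single ρ g 1 := by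
          rw [CovAlg.single_mul_single]; simp
        rw [this, of_mul, Lmul, map_mul, hL, hL]
        have h1 := hΨ.1 a
        have h2 := hΨ.2 g
        simp only [incl, unit] at h1 h2
        rw [h1, h2]; simp

end CrossedProduct

end CrossedProduct

/-! ### Crossed products by a homeomorphism -/

/-- The action `σ` of `ℤ` on `C(X)` induced by a homeomorphism `T`: `σ_m(f)(x) = f(T⁻ᵐ x)`. -/
def homeoAction {X : Type*} [TopologicalSpace X] [CompactSpace X] (T : X ≃ₜ X) :
    Multiplicative ℤ →* (C(X, ℂ) ≃⋆ₐ[ℂ] C(X, ℂ)) :=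
  zpowersHom _ (T.symm.compStarAlgEquiv' ℂ ℂ)

/-- The crossed product `C(X) ⋊_T ℤ` by a homeomorphism `T` of a compact space. -/
abbrev HomeoCrossedProduct {X : Type*} [TopologicalSpace X] [CompactSpace X] (T : X ≃ₜ X) :
    Type _ :=
  CrossedProduct (homeoAction T)

/-! ### Odometers, supernatural numbers and Bunce-Deddens algebras -/

section Odometer

variable {n : ℕ → ℕ}

/-- Addition of `1` with carry: the digit in place `k` is increased by `1` modulo `n k` when all
earlier digits are maximal, and left unchanged otherwise. -/
def addOne (x : ∀ k, Fin (n k)) : ∀ k, Fin (n k) := fun k =>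
  if ∀ j < k, (x j : ℕ) + 1 = n j then ⟨((x k : ℕ) + 1) % n k, Nat.mod_lt _ (x k).pos⟩ else x k

/-- Subtraction of `1` with borrow. -/
def subOne (x : ∀ k, Fin (n k)) : ∀ k, Fin (n k) := fun k =>
  if ∀ j < k, (x j : ℕ) = 0 then ⟨((x k : ℕ) + (n k - 1)) % n k, Nat.mod_lt _ (x k).pos⟩ else x k

theorem addOne_eq_zero_iff (x : ∀ k, Fin (n k)) (k : ℕ) :
    (∀ j < k, (addOne x j : ℕ) = 0) ↔ ∀ j < k, (x j : ℕ) + 1 = n j := by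
  induction k with
  | zero => simp
  | succ k ih =>
    simp only [Nat.lt_succ_iff_lt_or_eq, or_imp, forall_and, forall_eq, ih]
    refine and_congr_right fun h => ?_
    have hk := (x k).isLt
    rw [addOne, if_pos h]
    change ((x k : ℕ) + 1) % n k = 0 ↔ _
    rcases Nat.lt_or_ge ((x k : ℕ) + 1) (n k) with h1 | h1
    · rw [Nat.mod_eq_of_lt h1]; omega
    · have : (x k : ℕ) + 1 = n k := by omega
      simp [this]

theorem subOne_eq_max_iff (x : ∀ k, Fin (n k)) (k : ℕ) :
    (∀ j < k, (subOne x j : ℕ) + 1 = n j) ↔ ∀ j < k, (x j : ℕ) = 0 := by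
  induction k with
  | zero => simp
  | succ k ih =>
    simp only [Nat.lt_succ_iff_lt_or_eq, or_imp, forall_and, forall_eq, ih]
    refine and_congr_right fun h => ?_
    have hk := (x k).isLt
    rw [subOne, if_pos h]
    change ((x k : ℕ) + (n k - 1)) % n k + 1 = n k ↔ _
    rcases Nat.eq_zero_or_pos (x k : ℕ) with h1 | h1
    · rw [h1, Nat.mod_eq_of_lt (by omega)]; omega
    · rw [show (x k : ℕ) + (n k - 1) = ((x k : ℕ) - 1) + n k by omega, Nat.add_mod_right,
        Nat.mod_eq_of_lt (by omega)]
      omega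

theorem subOne_addOne (x : ∀ k, Fin (n k)) : subOne (addOne x) = x := by
  funext k
  apply Fin.ext
  rw [subOne]
  simp only [addOne_eq_zero_iff]
  have hk := (x k).isLt
  split_ifs with h
  · have e : (addOne x k : ℕ) = ((x k : ℕ) + 1) % n k := by rw [addOne, if_pos h]
    change ((addOne x k : ℕ) + (n k - 1)) % n k = _
    rw [e, Nat.mod_add_mod, show (x k : ℕ) + 1 + (n k - 1) = x k + n k by omega, Nat.add_mod_right,
      Nat.mod_eq_of_lt hk]
  · unfold addOne; rw [if_neg h]

theorem addOne_subOne (x : ∀ k, Fin (n k)) : addOne (subOne x) = x := by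
  funext k
  apply Fin.ext
  rw [addOne]
  simp only [subOne_eq_max_iff]
  have hk := (x k).isLt
  split_ifs with h
  · have e : (subOne x k : ℕ) = ((x k : ℕ) + (n k - 1)) % n k := by rw [subOne, if_pos h]
    change ((subOne x k : ℕ) + 1) % n k = _
    rw [e, Nat.mod_add_mod, show (x k : ℕ) + (n k - 1) + 1 = x k + n k by omega, Nat.add_mod_right,
      Nat.mod_eq_of_lt hk]
  · unfold subOne; rw [if_neg h]

theorem continuous_addOne : Continuous (addOne : (∀ k, Fin (n k)) → ∀ k, Fin (n k)) := by
  refine continuous_pi fun k => ?_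
  refine IsLocallyConstant.continuous ?_
  rw [IsLocallyConstant.iff_eventually_eq]
  intro x
  have h : ∀ᶠ y in nhds x, ∀ j ∈ Finset.range (k + 1), y j = x j := by
    rw [Filter.eventually_all_finset]
    intro j _
    exact (continuous_apply j).continuousAt.eventually
      (show ∀ᶠ z in nhds (x j), z = x j by rw [nhds_discrete]; rfl)
  filter_upwards [h] with y hy
  have hy' : ∀ j < k, y j = x j := fun j hj => hy j (by simp; omega)
  have hiff : (∀ j < k, (y j : ℕ) + 1 = n j) ↔ ∀ j < k, (x j : ℕ) + 1 = n j :=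
    forall₂_congr fun j hj => by rw [hy' j hj]
  simp only [addOne, hiff, hy k (by simp)]

end Odometer

/-- The odometer on `∏ₖ {0, …, n k - 1}`: addition of `1` with carry. -/
def odometer (n : ℕ → ℕ) : (∀ k, Fin (n k)) ≃ₜ (∀ k, Fin (n k)) :=
  Continuous.homeoOfEquivCompactToT2
    (f := { toFun := addOne, invFun := subOne, left_inv := subOne_addOne,
            right_inv := addOne_subOne })
    continuous_addOne

/-- A supernatural number `∏ₚ p ^ s(p)`, recorded by its exponents. -/
abbrev Supernatural : Type := Nat.Primes → ℕ∞

/-- The supernatural number `∏ₖ n k` of a sequence of positive integers: the exponent of `p` is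
the supremum of its exponents in the partial products. -/
def supernaturalProd (n : ℕ → ℕ) : Supernatural := fun p =>
  ⨆ m : ℕ, (((∏ k ∈ Finset.range m, n k).factorization p : ℕ) : ℕ∞)

/-- The supernatural number `d ∏_{p ∈ F} p^∞`, for a positive integer `d`. -/
def mulPrimesInfty (d : ℕ) (F : Finset Nat.Primes) : Supernatural := fun p =>
  if p ∈ F then ⊤ else ((d.factorization p : ℕ) : ℕ∞)

/-- `B` is (isomorphic to) the Bunce-Deddens algebra with supernatural number `s`: the crossed
product by the odometer of a sequence of integers `n k ≥ 2` with `∏ₖ n k = s`. -/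
def IsBunceDeddens (B : Type*) [CStarAlgebra B] (s : Supernatural) : Prop :=
  ∃ n : ℕ → ℕ, (∀ k, 2 ≤ n k) ∧ supernaturalProd n = s ∧
    Nonempty (B ≃⋆ₐ[ℂ] HomeoCrossedProduct (odometer n))

/-! ### The group `𝒰(ℤ_F)` and the action of `q` -/

instance instFactPrime (p : Nat.Primes) : Fact (p : ℕ).Prime := ⟨p.2⟩

/-- The compact ring `ℤ_F = ∏_{p ∈ F} ℤ_p`; its group of units is `𝒰(ℤ_F)`. -/
abbrev ZF (F : Finset Nat.Primes) : Type := ∀ p : F, ℤ_[(p : Nat.Primes)]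

section Units

variable {F : Finset Nat.Primes} {q : Nat.Primes}

theorem coprime_of_notMem (hq : q ∉ F) (p : F) : Nat.Coprime (q : ℕ) (p : Nat.Primes) :=
  (Nat.coprime_primes q.2 (p : Nat.Primes).2).2 fun h =>
    hq (by rw [show q = p from Subtype.ext h]; exact p.2)

theorem isUnit_natCast_ZF (hq : q ∉ F) : IsUnit ((q : ℕ) : ZF F) := by
  rw [Pi.isUnit_iff]
  intro p
  rw [Pi.natCast_apply, PadicInt.isUnit_iff]
  exact PadicInt.norm_natCast_eq_one_iff.2 (coprime_of_notMem hq p).symm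

/-- Multiplication by `q` on `𝒰(ℤ_F)`. -/
def mulByPrime (hq : q ∉ F) : (ZF F)ˣ ≃ₜ (ZF F)ˣ := Homeomorph.mulLeft (isUnit_natCast_ZF hq).unit

/-- The order `o_l(q)` of `q` in `∏_{p ∈ F} 𝒰(ℤ / p ^ l_p)`. -/
def unitOrder (hq : q ∉ F) (l : F → ℕ) : ℕ :=
  orderOf (fun p : F => ZMod.unitOfCoprime (q : ℕ) ((coprime_of_notMem hq p).pow_right (l p)) :
    ∀ p : F, (ZMod (((p : Nat.Primes) : ℕ) ^ l p))ˣ)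

end Units

end CStarDynamics

end

/-!
The multiplication by `q` on `𝒰(ℤ_F)` is a disjoint union of finitely many copies of one odometer,
and the crossed product by a disjoint union of copies is a direct sum of copies of the crossed
product.

Arithmetic. The order of `q` modulo `p ^ (M + l)` is `e * p ^ l` for suitable `M` and `e`
(`exists_orderOf_natCast_eq`). The order in the product over `F` is the least common multiple of
these orders, in which the exponents of the primes of `F` grow linearly as soon as each `K p` is
large enough for the `p`-th order to dominate the `p`-adic valuations of the others
(`lcm_mul_pow_add`).

Dynamics. The orders and the orders of the groups `∏ p ∈ F, 𝒰(ℤ / p ^ (K p + k))` grow by the same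
factor, so the subgroup generated by `q` has the same index at every level
(`index_zpowers_reduction`). Hence the coset of a unit is determined at level `K`, and within a
coset a unit is a coherent sequence of exponents of `q` modulo `d P ^ k`, where `P = ∏ p ∈ F, p`.
Their mixed radix digits conjugate the rotation by `q` to the odometer
(`exists_homeomorph_prod_odometer`, `exists_homeomorph_mulByPrime`).

Operator algebra. Equivariant maps induce homomorphisms of crossed products by the universal
property, and the inclusions of the copies, the projection onto one copy and the indicator
functions of the copies give the decomposition (`nonempty_crossedProduct_starAlgEquiv_pi`).
-/

noncomputable section

namespace CStarDynamics

/-! ### Orders of a prime modulo products of prime powers -/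

/-- With `e` the order of `q` modulo `p ^ 2`, and `M ≥ 2` the exponent of `p` in `q ^ e - 1`, the
order of `q ^ e` modulo `p ^ (M + l)` is `p ^ l`. Working modulo `p ^ 2` treats `p = 2` together
with the odd primes. -/
theorem exists_orderOf_natCast_eq {p q : ℕ} (hp : p.Prime) (hq : 2 ≤ q) (hqp : q.Coprime p) :
    ∃ M e : ℕ, 1 ≤ M ∧ 0 < e ∧ ∀ l, orderOf (q : ZMod (p ^ (M + l))) = e * p ^ l := by
  have : Fact p.Prime := ⟨hp⟩
  have hunit : ∀ k, IsUnit (q : ZMod (p ^ k)) := fun k =>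
    (ZMod.isUnit_iff_coprime q _).2 (hqp.pow_right k)
  have hne : ∀ k, NeZero (p ^ k) := fun k => ⟨pow_ne_zero _ hp.ne_zero⟩
  have hpos : ∀ k, 0 < orderOf (q : ZMod (p ^ k)) := fun k => by
    obtain ⟨u, hu⟩ := hunit k
    rw [← hu, orderOf_units]
    exact orderOf_pos u
  set e := orderOf (q : ZMod (p ^ 2)) with he
  have h1 : 1 < q ^ e := Nat.one_lt_pow (hpos 2).ne' hq
  obtain ⟨M, a, ha, hMa⟩ := Nat.exists_eq_pow_mul_and_not_dvd
    (show q ^ e - 1 ≠ 0 by omega) p hp.ne_one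
  have hqe : q ^ e = 1 + p ^ M * a := by omega
  have hM : 2 ≤ M := by
    have hd : p ^ 2 ∣ p ^ M * a := by
      rw [← hMa, ← ZMod.natCast_eq_zero_iff, Nat.cast_sub h1.le]
      push_cast
      rw [pow_orderOf_eq_one, sub_self]
    have := Nat.Coprime.dvd_of_dvd_mul_right
      ((Nat.Prime.coprime_iff_not_dvd hp).2 ha |>.pow_left 2) hd
    exact (Nat.pow_dvd_pow_iff_le_right hp.one_lt).1 this
  refine ⟨M, e, by omega, hpos 2, fun l => ?_⟩
  have hdvd : e ∣ orderOf (q : ZMod (p ^ (M + l))) := by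
    have := orderOf_map_dvd
      (ZMod.castHom (pow_dvd_pow p (show 2 ≤ M + l by omega)) (ZMod (p ^ 2))).toMonoidHom
      (q : ZMod (p ^ (M + l)))
    simpa using this
  have hord : orderOf ((q : ZMod (p ^ (M + l))) ^ e) = p ^ l := by
    have := ZMod.orderOf_one_add_mul_prime_pow hp M (by omega)
      (by nlinarith [hp.two_le]) (a : ℤ) (by exact_mod_cast ha) l
    rw [add_comm l M] at this
    rw [← this, ← Nat.cast_pow, hqe]
    push_cast
    rfl
  rw [orderOf_pow_of_dvd (hpos 2).ne' hdvd] at hord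
  rw [← hord, Nat.mul_div_cancel' hdvd]

/-- Once `b` bounds the `p`-adic valuations of all the `e p'`, the `p`-part of the least common
multiple is that of its `p`-th term, so it grows with `l p`. -/
theorem lcm_mul_pow_add {ι : Type*} [Fintype ι] {p : ι → ℕ} (hp : ∀ i, (p i).Prime)
    (hinj : Function.Injective p) {e : ι → ℕ} (he : ∀ i, 0 < e i) {b : ℕ}
    (hb : ∀ i j, (e i).factorization (p j) ≤ b) (l : ι → ℕ) :
    (Finset.univ.lcm fun i => e i * p i ^ (b + l i)) =
      (Finset.univ.lcm fun i => e i * p i ^ b) * ∏ i, p i ^ l i := by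
  classical
  have hne : ∀ (m : ι → ℕ) i, e i * p i ^ m i ≠ 0 := fun m i =>
    mul_ne_zero (he i).ne' (pow_ne_zero _ (hp i).ne_zero)
  have hlcm : ∀ m : ι → ℕ, (Finset.univ.lcm fun i => e i * p i ^ m i) ≠ 0 := fun m => by
    rw [Ne, Finset.lcm_eq_zero_iff]
    simpa using fun i => ⟨(he i).ne', fun h => absurd h (hp i).ne_zero⟩
  have hprod : ∏ i, p i ^ l i ≠ 0 :=
    Finset.prod_ne_zero_iff.2 fun i _ => pow_ne_zero _ (hp i).ne_zero
  have hterm : ∀ (m : ι → ℕ) (i : ι) (r : ℕ), (e i * p i ^ m i).factorization r =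
      (e i).factorization r + if p i = r then m i else 0 := fun m i r => by
    rw [Nat.factorization_mul (he i).ne' (pow_ne_zero _ (hp i).ne_zero), (hp i).factorization_pow]
    simp [Finsupp.single_apply]
  have hprodf : ∀ r, (∏ i, p i ^ l i).factorization r = ∑ i, if p i = r then l i else 0 :=
    fun r => by
      rw [Nat.factorization_prod_apply fun i _ => pow_ne_zero _ (hp i).ne_zero]
      refine Finset.sum_congr rfl fun i _ => ?_
      rw [(hp i).factorization_pow, Finsupp.single_apply]
  refine Nat.eq_of_factorization_eq (hlcm fun i => b + l i) (mul_ne_zero (hlcm fun _ => b) hprod)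
    fun r => ?_
  rw [Nat.factorization_mul (hlcm fun _ => b) hprod, Finsupp.add_apply, hprodf,
    Finset.factorization_lcm (fun i _ => hne (fun i => b + l i) i),
    Finset.factorization_lcm (fun i _ => hne (fun _ => b) i)]
  simp only [hterm (fun i => b + l i), hterm fun _ => b]
  by_cases hr : ∃ j, p j = r
  · obtain ⟨j, rfl⟩ := hr
    have hsup : ∀ m : ι → ℕ, (∀ i, b ≤ m i) →
        (Finset.univ.sup fun i => (e i).factorization (p j) + if p i = p j then m i else 0) =
          (e j).factorization (p j) + m j := fun m hm => by
      refine le_antisymm (Finset.sup_le fun i _ => ?_) ?_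
      · split_ifs with h
        · rw [hinj h]
        · have := hb i j
          have := hm j
          omega
      · exact (le_of_eq (by simp)).trans (Finset.le_sup (f := fun i =>
          (e i).factorization (p j) + if p i = p j then m i else 0) (Finset.mem_univ j))
    rw [hsup _ fun i => Nat.le_add_right _ _, hsup _ fun _ => le_rfl,
      Finset.sum_eq_single j (fun i _ hi => if_neg fun h => hi (hinj h)) (by simp)]
    simp [add_assoc]
  · push Not at hr
    simp [hr]

section UnitOrder

variable {F : Finset Nat.Primes} {q : Nat.Primes}

theorem unitOrder_eq_lcm (hq : q ∉ F) (l : F → ℕ) :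
    unitOrder hq l =
      Finset.univ.lcm fun p : F => orderOf ((q : ℕ) : ZMod (((p : Nat.Primes) : ℕ) ^ l p)) := by
  rw [unitOrder, Pi.orderOf]
  congr 1
  funext p
  rw [← orderOf_units, ZMod.coe_unitOfCoprime]

theorem exists_unitOrder_add_eq (hq : q ∉ F) :
    ∃ (K : F → ℕ) (d : ℕ), (∀ p, 1 ≤ K p) ∧ 0 < d ∧
      ∀ l : F → ℕ, unitOrder hq (K + l) = d * ∏ p : F, ((p : Nat.Primes) : ℕ) ^ l p := by
  choose M e hM he h using fun p : F =>
    exists_orderOf_natCast_eq (p : Nat.Primes).2 q.2.two_le (coprime_of_notMem hq p)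
  set b : ℕ := ∑ i : F, ∑ j : F, (e i).factorization ((j : Nat.Primes) : ℕ) with hbdef
  have hb : ∀ i j : F, (e i).factorization ((j : Nat.Primes) : ℕ) ≤ b := fun i j =>
    (Finset.single_le_sum (f := fun j : F => (e i).factorization ((j : Nat.Primes) : ℕ))
      (fun _ _ => Nat.zero_le _) (Finset.mem_univ j)).trans
    (Finset.single_le_sum (f := fun i : F => ∑ j : F, (e i).factorization ((j : Nat.Primes) : ℕ))
      (fun _ _ => Nat.zero_le _) (Finset.mem_univ i))
  refine ⟨fun p => M p + b, Finset.univ.lcm fun p : F => e p * ((p : Nat.Primes) : ℕ) ^ b,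
    fun p => (hM p).trans (Nat.le_add_right _ _), ?_, fun l => ?_⟩
  · refine Nat.pos_of_ne_zero fun h0 => ?_
    rw [Finset.lcm_eq_zero_iff] at h0
    obtain ⟨p, -, hp⟩ := h0
    exact mul_ne_zero (he p).ne' (pow_ne_zero _ (p : Nat.Primes).2.ne_zero) hp
  · rw [← lcm_mul_pow_add (fun p : F => (p : Nat.Primes).2)
      (fun i j hij => Subtype.ext (Subtype.ext hij)) he hb, unitOrder_eq_lcm]
    congr 1
    funext p
    rw [← h p (b + l p), Pi.add_apply, add_assoc]

end UnitOrder

/-! ### Crossed products by conjugate and decomposable homeomorphisms -/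

section Functoriality

variable {X Y : Type*} [TopologicalSpace X] [CompactSpace X] [TopologicalSpace Y] [CompactSpace Y]
  {S : X ≃ₜ X} {T : Y ≃ₜ Y}

theorem homeoAction_comp_of_semiconj (π : C(Y, X)) (hπ : Function.Semiconj π T S)
    (g : Multiplicative ℤ) (f : C(X, ℂ)) :
    (homeoAction S g f).comp π = homeoAction T g (f.comp π) := by
  have h1 : ∀ f : C(X, ℂ), (homeoAction S (.ofAdd 1) f).comp π =
      homeoAction T (.ofAdd 1) (f.comp π) := fun f => by
    ext y
    simp only [homeoAction, zpowersHom_apply, toAdd_ofAdd, zpow_one]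
    change f (S.symm (π y)) = f (π (T.symm y))
    congr 1
    rw [S.symm_apply_eq, ← hπ, T.apply_symm_apply]
  have hpow : ∀ (n : ℕ) (f : C(X, ℂ)), (homeoAction S (.ofAdd 1 ^ n) f).comp π =
      homeoAction T (.ofAdd 1 ^ n) (f.comp π) := fun n => by
    induction n with
    | zero => intro f; simp
    | succ n ih =>
      intro f
      rw [pow_succ, map_mul, map_mul, StarAlgEquiv.mul_apply, StarAlgEquiv.mul_apply, ih, h1]
  have hinv : ∀ g, (∀ f : C(X, ℂ), (homeoAction S g f).comp π = homeoAction T g (f.comp π)) →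
      ∀ f : C(X, ℂ), (homeoAction S g⁻¹ f).comp π = homeoAction T g⁻¹ (f.comp π) :=
    fun g hg f => by
      rw [← CovAlg.apply_inv_apply (ρ := homeoAction T) g ((homeoAction S g⁻¹ f).comp π), ← hg,
        CovAlg.apply_apply_inv]
  obtain ⟨n, hn⟩ | ⟨n, hn⟩ : (∃ n : ℕ, g = .ofAdd 1 ^ n) ∨ ∃ n : ℕ, g = (.ofAdd 1 ^ n)⁻¹ := by
    obtain ⟨n, hn | hn⟩ := Int.eq_nat_or_neg (Multiplicative.toAdd g)
    · exact .inl ⟨n, Multiplicative.toAdd.injective (by simp [hn])⟩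
    · exact .inr ⟨n, Multiplicative.toAdd.injective (by simp [hn])⟩
  · rw [hn]; exact hpow n f
  · rw [hn]; exact hinv _ (hpow n) f

namespace CrossedProduct

theorem incl_mul_unit {G A : Type*} [Group G] [CStarAlgebra A] (ρ : G →* (A ≃⋆ₐ[ℂ] A)) (g : G)
    (a : A) : incl ρ a * unit ρ g = of (CovAlg.single ρ g a) := by
  rw [incl, unit, ← of_mul, CovAlg.single_mul_single]
  simp

theorem unit_mem_unitary {G A : Type*} [Group G] [CStarAlgebra A] (ρ : G →* (A ≃⋆ₐ[ℂ] A)) (g : G) :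
    unit ρ g ∈ unitary (CrossedProduct ρ) := by
  rw [Unitary.mem_iff]
  constructor <;>
  · simp [unit, star_of, CovAlg.star_single, ← of_mul, CovAlg.single_mul_single,
      ← CovAlg.one_def, of_one]

/-- The canonical homomorphism from `G` to the unitary group of `A ⋊ G`. -/
def unitHom {G A : Type*} [Group G] [CStarAlgebra A] (ρ : G →* (A ≃⋆ₐ[ℂ] A)) :
    G →* unitary (CrossedProduct ρ) where
  toFun g := ⟨unit ρ g, unit_mem_unitary ρ g⟩
  map_one' := Subtype.ext (by simp [unit, ← CovAlg.one_def, of_one])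
  map_mul' g h := Subtype.ext (by
    simp [unit, ← of_mul, CovAlg.single_mul_single])

/-- The canonical embedding of `A` in `A ⋊ G`, as a *-homomorphism. -/
def inclHom {G A : Type*} [Group G] [CStarAlgebra A] (ρ : G →* (A ≃⋆ₐ[ℂ] A)) :
    A →⋆ₐ[ℂ] CrossedProduct ρ where
  toFun := incl ρ
  map_one' := by simp [incl, ← CovAlg.one_def, of_one]
  map_zero' := by simp [incl, CovAlg.single_zero, of_zero]
  map_mul' a b := by simp [incl, ← of_mul, CovAlg.single_mul_single]
  map_add' a b := by simp [incl, ← of_add, CovAlg.single_add]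
  commutes' c := by
    rw [Algebra.algebraMap_eq_smul_one, Algebra.algebraMap_eq_smul_one, incl, ← CovAlg.smul_single,
      of_smul, ← CovAlg.one_def, of_one]
  map_star' a := by simp [incl, star_of, CovAlg.star_single]

end CrossedProduct

open CrossedProduct

/-- Crossed products by homeomorphisms are functorial: pulling back along an equivariant map of
spaces extends to the crossed products and fixes the canonical unitaries. -/
theorem exists_crossedProduct_map (π : C(Y, X)) (hπ : Function.Semiconj π T S) :
    ∃ Φ : HomeoCrossedProduct S →⋆ₐ[ℂ] HomeoCrossedProduct T,
      (∀ f, Φ (incl _ f) = incl _ (f.comp π)) ∧ ∀ g, Φ (unit _ g) = unit _ g :=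
  (existsUnique_lift ((inclHom (homeoAction T)).comp (π.compStarAlgHom' ℂ ℂ))
    (unitHom (homeoAction T)) fun g f => by
      change incl _ ((homeoAction S g f).comp π) = unit _ g * incl _ (f.comp π) * star (unit _ g)
      rw [unit_mul_incl_mul_star_unit, homeoAction_comp_of_semiconj π hπ]).exists

/-- Two continuous additive maps on a crossed product that agree on the elements `a u_g` are
equal. -/
theorem CrossedProduct.addMonoidHom_ext {G A B : Type*} [Group G] [CStarAlgebra A]
    [AddCommMonoid B] [TopologicalSpace B] [T2Space B] {ρ : G →* (A ≃⋆ₐ[ℂ] A)}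
    {Φ Ψ : CrossedProduct ρ →+ B} (hΦ : Continuous Φ) (hΨ : Continuous Ψ)
    (h : ∀ a g, Φ (incl ρ a * unit ρ g) = Ψ (incl ρ a * unit ρ g)) : Φ = Ψ := by
  ext x
  induction x using CrossedProduct.induction with
  | hP => exact isClosed_eq hΦ hΨ
  | h x =>
    induction x using CovAlg.induction with
    | zero => rw [of_zero, map_zero, map_zero]
    | add x y hx hy => rw [of_add, map_add, hx, hy, map_add]
    | single g a => rw [← incl_mul_unit, h]

theorem continuous_starAlgHom {A B : Type*} [CStarAlgebra A] [CStarAlgebra B] (Φ : A →⋆ₐ[ℂ] B) :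
    Continuous Φ :=
  AddMonoidHomClass.continuous_of_bound Φ 1 fun x => by
    simpa using NonUnitalStarAlgHom.norm_apply_le Φ x

/-- If `T` is conjugate to `id × S` on `ι × X` with `ι` finite, then `C(Y) ⋊_T ℤ` is the direct sum
of `ι` copies of `C(X) ⋊_S ℤ`. The `i`-th coordinate of the isomorphism restricts functions to the
`i`-th copy of `X`. Its inverse is `b ↦ ∑ i, p i * Ψ (b i)`, where `p i` is the indicator function
of the `i`-th copy and `Ψ` is induced by the projection of `Y` to `X`. -/
theorem nonempty_crossedProduct_starAlgEquiv_pi {ι : Type*} [Fintype ι]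
    [TopologicalSpace ι] [DiscreteTopology ι] (h : Y ≃ₜ ι × X)
    (hT : ∀ y, h (T y) = ((h y).1, S (h y).2)) :
    Nonempty (HomeoCrossedProduct T ≃⋆ₐ[ℂ] (ι → HomeoCrossedProduct S)) := by
  classical
  let j : ι → C(X, Y) := fun i => ⟨fun x => h.symm (i, x), by fun_prop⟩
  let pr : C(Y, X) := ⟨fun y => (h y).2, by fun_prop⟩
  let p : ι → C(Y, ℂ) := fun i =>
    ⟨fun y => if (h y).1 = i then 1 else 0,
      (continuous_of_discreteTopology (f := fun k : ι => if k = i then (1 : ℂ) else 0)).comp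
        (continuous_fst.comp h.continuous)⟩
  have hj : ∀ i, Function.Semiconj (j i) S T := fun i x => by
    apply h.injective
    change h (h.symm (i, S x)) = h (T (h.symm (i, x)))
    rw [hT]
    simp
  have hpr : Function.Semiconj pr T S := fun y => congr_arg Prod.snd (hT y)
  choose Φ hΦi hΦu using fun i => exists_crossedProduct_map (j i) (hj i)
  obtain ⟨Ψ, hΨi, hΨu⟩ := exists_crossedProduct_map pr hpr
  have hprj : ∀ i (f : C(X, ℂ)), (f.comp pr).comp (j i) = f := fun i f => by
    ext x
    simp [pr, j]
  have hpj : ∀ i k, (p k).comp (j i) = if i = k then 1 else 0 := fun i k => by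
    ext x
    by_cases hik : i = k <;> simp [p, j, hik]
  have hsum : ∀ f : C(Y, ℂ), ∑ i, p i * (f.comp (j i)).comp pr = f := fun f => by
    ext y
    simp only [ContinuousMap.coe_sum, Finset.sum_apply, ContinuousMap.mul_apply]
    rw [Finset.sum_eq_single (h y).1 (fun i _ hi => by simp [p, hi.symm]) (by simp)]
    simp [p, pr, j]
  have hΦΨ : ∀ i b, Φ i (Ψ b) = b := fun i b =>
    DFunLike.congr_fun (CrossedProduct.addMonoidHom_ext
      (Φ := ((Φ i).comp Ψ : _ →+ _)) (Ψ := AddMonoidHom.id _)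
      (continuous_starAlgHom ((Φ i).comp Ψ)) continuous_id fun a g => by
        change Φ i (Ψ (incl _ a * unit _ g)) = incl _ a * unit _ g
        rw [map_mul, map_mul, hΨi, hΨu, hΦi, hΦu, hprj]) b
  have hΦp : ∀ i k, Φ i (incl _ (p k)) = if i = k then 1 else 0 := fun i k => by
    rw [hΦi, hpj]
    split_ifs
    · exact map_one (inclHom (homeoAction S))
    · exact map_zero (inclHom (homeoAction S))
  have hΨΦ : ∀ x, ∑ i, incl _ (p i) * Ψ (Φ i x) = x := fun x => by
    have := CrossedProduct.addMonoidHom_ext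
      (Φ := ∑ i, (AddMonoidHom.mulLeft (incl (homeoAction T) (p i))).comp
        ((Ψ.comp (Φ i) : _ →⋆ₐ[ℂ] _) : _ →+ _)) (Ψ := AddMonoidHom.id _)
      (by
        have hc : Continuous fun x => ∑ i, incl (homeoAction T) (p i) * Ψ (Φ i x) :=
          continuous_finsetSum _ fun i _ =>
            continuous_const.mul (continuous_starAlgHom (Ψ.comp (Φ i)))
        convert hc using 1
        ext x
        rw [AddMonoidHom.finsetSum_apply]
        rfl) continuous_id
      fun a g => by
        rw [AddMonoidHom.finsetSum_apply]
        change ∑ i, incl _ (p i) * Ψ (Φ i (incl _ a * unit _ g)) = incl _ a * unit _ g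
        simp only [map_mul, hΦi, hΦu, hΨi, hΨu, ← mul_assoc, ← Finset.sum_mul]
        congr 1
        conv_rhs => rw [← hsum a]
        change ∑ i, inclHom (homeoAction T) (p i) *
          inclHom (homeoAction T) ((a.comp (j i)).comp pr) = inclHom (homeoAction T) _
        simp only [map_sum, map_mul]
    have hx := DFunLike.congr_fun this x
    rwa [AddMonoidHom.finsetSum_apply] at hx
  let Θ : HomeoCrossedProduct T →⋆ₐ[ℂ] (ι → HomeoCrossedProduct S) :=
    { toFun := fun x i => Φ i x
      map_one' := funext fun i => map_one (Φ i)
      map_zero' := funext fun i => map_zero (Φ i)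
      map_mul' := fun x y => funext fun i => map_mul (Φ i) x y
      map_add' := fun x y => funext fun i => map_add (Φ i) x y
      commutes' := fun c => funext fun i => AlgHomClass.commutes (Φ i) c
      map_star' := fun x => funext fun i => map_star (Φ i) x }
  refine ⟨StarAlgEquiv.ofBijective Θ ⟨fun x y hxy => ?_, fun b => ?_⟩⟩
  · rw [← hΨΦ x, ← hΨΦ y]
    exact Finset.sum_congr rfl fun i _ => by rw [show Φ i x = Φ i y from congr_fun hxy i]
  · refine ⟨∑ k, incl _ (p k) * Ψ (b k), funext fun i => ?_⟩
    change Φ i _ = b i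
    simp [map_sum, map_mul, hΦΨ, hΦp]

end Functoriality

/-! ### Recognizing odometers -/

section Recognition

variable {n : ℕ → ℕ}

/-- The integer `∑ j < k, x j * (n 0 ⋯ n (j - 1))` whose mixed radix digits are the first `k`
entries of `x`. -/
def odometerValue (x : ∀ k, Fin (n k)) (k : ℕ) : ℕ :=
  ∑ j ∈ Finset.range k, (x j : ℕ) * ∏ i ∈ Finset.range j, n i

theorem odometerValue_succ (x : ∀ k, Fin (n k)) (k : ℕ) :
    odometerValue x (k + 1) = odometerValue x k + (x k : ℕ) * ∏ i ∈ Finset.range k, n i :=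
  Finset.sum_range_succ _ _

theorem odometerValue_lt (x : ∀ k, Fin (n k)) (k : ℕ) :
    odometerValue x k < ∏ i ∈ Finset.range k, n i := by
  induction k with
  | zero => simp [odometerValue]
  | succ k ih =>
    rw [odometerValue_succ, Finset.prod_range_succ]
    nlinarith [(x k).isLt]

theorem eq_of_odometerValue_eq {x y : ∀ k, Fin (n k)} {k : ℕ}
    (h1 : odometerValue x k = odometerValue y k)
    (h2 : odometerValue x (k + 1) = odometerValue y (k + 1)) : x k = y k := by
  rw [odometerValue_succ, odometerValue_succ, h1, Nat.add_left_cancel_iff] at h2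
  exact Fin.ext (Nat.eq_of_mul_eq_mul_right (by have := odometerValue_lt x k; omega) h2)

theorem odometerValue_addOne_aux (x : ∀ k, Fin (n k)) (k : ℕ) :
    ((∀ j < k, (x j : ℕ) + 1 = n j) → odometerValue (addOne x) k = 0 ∧
      odometerValue x k + 1 = ∏ i ∈ Finset.range k, n i) ∧
    ((¬ ∀ j < k, (x j : ℕ) + 1 = n j) →
      odometerValue (addOne x) k = odometerValue x k + 1) := by
  induction k with
  | zero => simp [odometerValue]
  | succ k ih =>
    rw [odometerValue_succ, odometerValue_succ, Finset.prod_range_succ]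
    rw [show (∀ j < k + 1, (x j : ℕ) + 1 = n j) ↔ (∀ j < k, (x j : ℕ) + 1 = n j) ∧
      (x k : ℕ) + 1 = n k from Nat.forall_lt_succ_right]
    by_cases h : ∀ j < k, (x j : ℕ) + 1 = n j
    · obtain ⟨h1, h2⟩ := ih.1 h
      have hval : (addOne x k : ℕ) = ((x k : ℕ) + 1) % n k := by rw [addOne, if_pos h]
      rw [h1, hval]
      refine ⟨fun hk => ?_, fun hk => ?_⟩
      · rw [hk.2, Nat.mod_self]
        refine ⟨by simp, ?_⟩
        rw [← h2]
        calc _ = (odometerValue x k + 1) * ((x k : ℕ) + 1) := by ring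
          _ = _ := by rw [hk.2]
      · have : (x k : ℕ) + 1 ≠ n k := fun h' => hk ⟨h, h'⟩
        rw [Nat.mod_eq_of_lt (by have := (x k).isLt; omega), ← h2]
        ring
    · refine ⟨fun hk => absurd hk.1 h, fun _ => ?_⟩
      rw [ih.2 h, addOne, if_neg h]
      ring

theorem natCast_odometerValue_addOne (x : ∀ k, Fin (n k)) (k : ℕ) :
    (odometerValue (addOne x) k : ZMod (∏ i ∈ Finset.range k, n i)) = odometerValue x k + 1 := by
  by_cases h : ∀ j < k, (x j : ℕ) + 1 = n j
  · obtain ⟨h1, h2⟩ := (odometerValue_addOne_aux x k).1 h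
    rw [h1, ← Nat.cast_one (R := ZMod _), ← Nat.cast_add, h2, ZMod.natCast_self, Nat.cast_zero]
  · rw [(odometerValue_addOne_aux x k).2 h]
    push_cast
    rfl

/-- A homeomorphism `T` of a compact space is conjugate to `id × odometer n` on `ι × ∏ₖ Fin (n k)`
if there are a `T`-invariant map to `ι` and compatible factor maps onto the rotations of
`ℤ / n 0 ⋯ n (k - 1)` by `1`, all locally constant, jointly separating points and, at each
level, jointly surjective. The conjugacy reads off mixed radix digits; its range is dense, and it
is closed by compactness. -/
theorem exists_homeomorph_prod_odometer {Y ι : Type*} [TopologicalSpace Y] [CompactSpace Y]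
    [TopologicalSpace ι] [DiscreteTopology ι] (T : Y ≃ₜ Y) (hn : ∀ k, 0 < n k)
    {c : Y → ι} {a : ∀ k, Y → ZMod (∏ i ∈ Finset.range k, n i)}
    (hc : IsLocallyConstant c) (ha : ∀ k, IsLocallyConstant (a k))
    (hcT : ∀ y, c (T y) = c y) (haT : ∀ k y, a k (T y) = a k y + 1)
    (hcompat : ∀ k y, (ZMod.cast (a (k + 1) y) : ZMod (∏ i ∈ Finset.range k, n i)) = a k y)
    (hsep : ∀ y y', c y = c y' → (∀ k, a k y = a k y') → y = y')
    (hsurj : ∀ i k m, ∃ y, c y = i ∧ a k y = (m : ℕ)) :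
    ∃ h : Y ≃ₜ ι × ∀ k, Fin (n k), ∀ y, h (T y) = ((h y).1, odometer n (h y).2) := by
  have hD : ∀ k, 0 < ∏ i ∈ Finset.range k, n i := fun k => Finset.prod_pos fun i _ => hn i
  have hne : ∀ k, NeZero (∏ i ∈ Finset.range k, n i) := fun k => ⟨(hD k).ne'⟩
  let dig : Y → ∀ k, Fin (n k) := fun y k =>
    ⟨(a (k + 1) y).val / ∏ i ∈ Finset.range k, n i, by
      rw [Nat.div_lt_iff_lt_mul (hD k), mul_comm, ← Finset.prod_range_succ]
      exact ZMod.val_lt _⟩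
  have hdig : ∀ y k, odometerValue (dig y) k = (a k y).val := fun y k => by
    induction k with
    | zero =>
      have : (a 0 y).val < 1 := (ZMod.val_lt (a 0 y)).trans_eq (by simp)
      exact (Nat.lt_one_iff.1 this).symm
    | succ k ih =>
      have hval : (a k y).val = (a (k + 1) y).val % ∏ i ∈ Finset.range k, n i := by
        rw [← hcompat k y, ZMod.cast_eq_val, ZMod.val_natCast]
      rw [odometerValue_succ, ih, hval]
      exact Nat.mod_add_div' _ _
  have hdigT : ∀ y, dig (T y) = addOne (dig y) := fun y => by
    have hval : ∀ k, odometerValue (dig (T y)) k = odometerValue (addOne (dig y)) k := fun k => by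
      rw [← Nat.mod_eq_of_lt (odometerValue_lt (dig (T y)) k),
        ← Nat.mod_eq_of_lt (odometerValue_lt (addOne (dig y)) k)]
      refine (ZMod.natCast_eq_natCast_iff' _ _ _).1 ?_
      rw [natCast_odometerValue_addOne, hdig, hdig, haT, ZMod.natCast_zmod_val,
        ZMod.natCast_zmod_val]
    exact funext fun k => eq_of_odometerValue_eq (hval k) (hval (k + 1))
  let f : Y → ι × ∀ k, Fin (n k) := fun y => (c y, dig y)
  have hf : Continuous f := hc.continuous.prodMk <| continuous_pi fun k =>
    ((ha (k + 1)).comp fun z => (⟨z.val / ∏ i ∈ Finset.range k, n i, by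
      rw [Nat.div_lt_iff_lt_mul (hD k), mul_comm, ← Finset.prod_range_succ]
      exact ZMod.val_lt _⟩ : Fin (n k))).continuous
  have hinj : Function.Injective f := fun y y' hy => by
    refine hsep y y' (congr_arg Prod.fst hy) fun k => ZMod.val_injective _ ?_
    rw [← hdig, ← hdig, show dig y = dig y' from congr_arg Prod.snd hy]
  have hfsurj : Function.Surjective f := by
    rintro ⟨i, x⟩
    choose y hyi hya using fun k => hsurj i k (odometerValue x k)
    -- The points `y k` agree with `(i, x)` in the first `k` digits.
    have hle : ∀ k j, j ≤ k → odometerValue (dig (y k)) j = odometerValue x j := by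
      intro k j hj
      have hcast : a j (y k) = (odometerValue x j : ℕ) := by
        induction hj using Nat.decreasingInduction with
        | self => exact hya k
        | of_succ j hj ih =>
          rw [← hcompat, ih, ZMod.cast_natCast
            (Finset.prod_range_succ n j ▸ dvd_mul_right _ _), odometerValue_succ]
          push_cast
          rw [← Nat.cast_prod, ZMod.natCast_self, mul_zero, add_zero]
      rw [hdig, hcast, ZMod.val_natCast, Nat.mod_eq_of_lt (odometerValue_lt x j)]
    have hlim : Filter.Tendsto (fun k => f (y k)) Filter.atTop (nhds (i, x)) := by
      refine Filter.Tendsto.prodMk_nhds ?_ (tendsto_pi_nhds.2 fun j => ?_)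
      · simp only [hyi]
        exact tendsto_const_nhds
      · refine tendsto_const_nhds.congr' ?_
        filter_upwards [Filter.eventually_ge_atTop (j + 1)] with k hk
        exact (eq_of_odometerValue_eq (hle k j (by omega)) (hle k (j + 1) hk)).symm
    exact (isCompact_range hf).isClosed.mem_of_tendsto hlim (.of_forall fun k => ⟨y k, rfl⟩)
  refine ⟨hf.homeoOfEquivCompactToT2 (f := Equiv.ofBijective f ⟨hinj, hfsurj⟩), fun y => ?_⟩
  exact Prod.ext (hcT y) (hdigT y)

end Recognition

/-! ### Multiplication by `q` on the units of `ℤ_F` -/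

section Units

variable {F : Finset Nat.Primes} {q : Nat.Primes}

/-- The group `∏ p ∈ F, 𝒰(ℤ / p ^ l p)`. -/
abbrev LevelUnits (F : Finset Nat.Primes) (l : F → ℕ) : Type :=
  ∀ p : F, (ZMod (((p : Nat.Primes) : ℕ) ^ l p))ˣ

/-- Reduction of units of `ℤ_F` modulo `p ^ l p` for each `p ∈ F`. -/
def reduction (l : F → ℕ) : (ZF F)ˣ →* LevelUnits F l :=
  MonoidHom.pi fun p => Units.map
    ((PadicInt.toZModPow (p := (p : Nat.Primes)) (l p)).comp (Pi.evalRingHom _ p)).toMonoidHom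

theorem coe_reduction (l : F → ℕ) (u : (ZF F)ˣ) (p : F) :
    (reduction l u p : ZMod (((p : Nat.Primes) : ℕ) ^ l p)) =
      PadicInt.toZModPow (l p) ((u : ZF F) p) := rfl

/-- The transition map between two levels. -/
def transition {l l' : F → ℕ} (h : l ≤ l') : LevelUnits F l' →* LevelUnits F l :=
  MonoidHom.pi fun p => (ZMod.unitsMap (pow_dvd_pow _ (h p))).comp (Pi.evalMonoidHom _ p)

theorem transition_reduction {l l' : F → ℕ} (h : l ≤ l') (u : (ZF F)ˣ) :
    transition h (reduction l' u) = reduction l u := by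
  funext p
  apply Units.ext
  rw [coe_reduction, ← PadicInt.cast_toZModPow _ _ (h p)]
  rfl

theorem reduction_surjective {l : F → ℕ} (hl : ∀ p, 1 ≤ l p) :
    Function.Surjective (reduction l) := fun g => by
  have hne : ∀ p : F, NeZero (((p : Nat.Primes) : ℕ) ^ l p) := fun p =>
    ⟨pow_ne_zero _ (p : Nat.Primes).2.ne_zero⟩
  have hunit : IsUnit (fun p => ((g p : ZMod (((p : Nat.Primes) : ℕ) ^ l p)).val : ℤ_[(p : Nat.Primes)]) : ZF F) := by
    rw [Pi.isUnit_iff]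
    intro p
    rw [PadicInt.isUnit_iff, PadicInt.norm_natCast_eq_one_iff]
    exact ((ZMod.val_coe_unit_coprime (g p)).coprime_dvd_right
      (dvd_pow_self _ (Nat.one_le_iff_ne_zero.1 (hl p)))).symm
  refine ⟨hunit.unit, funext fun p => Units.ext ?_⟩
  rw [coe_reduction, IsUnit.unit_spec, map_natCast, ZMod.natCast_zmod_val]

theorem transition_surjective {l l' : F → ℕ} (h : l ≤ l') (hl : ∀ p, 1 ≤ l p) :
    Function.Surjective (transition h) := fun g => by
  obtain ⟨u, rfl⟩ := reduction_surjective hl g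
  exact ⟨reduction l' u, transition_reduction h u⟩

theorem card_levelUnits {l : F → ℕ} (hl : ∀ p, 1 ≤ l p) : Nat.card (LevelUnits F l) =
    ∏ p : F, (((p : Nat.Primes) : ℕ) - 1) * ((p : Nat.Primes) : ℕ) ^ (l p - 1) := by
  rw [Nat.card_pi]
  refine Finset.prod_congr rfl fun p _ => ?_
  have : NeZero (((p : Nat.Primes) : ℕ) ^ l p) := ⟨pow_ne_zero _ (p : Nat.Primes).2.ne_zero⟩
  rw [Nat.card_eq_fintype_card, ZMod.card_units_eq_totient,
    Nat.totient_prime_pow (p : Nat.Primes).2 (hl p), mul_comm]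

theorem finite_levelUnits (l : F → ℕ) : Finite (LevelUnits F l) := by
  have : ∀ p : F, NeZero (((p : Nat.Primes) : ℕ) ^ l p) := fun p =>
    ⟨pow_ne_zero _ (p : Nat.Primes).2.ne_zero⟩
  exact Pi.finite

theorem isLocallyConstant_toZModPow {p : ℕ} [Fact p.Prime] (n : ℕ) :
    IsLocallyConstant (PadicInt.toZModPow (p := p) n) := by
  rw [IsLocallyConstant.iff_eventually_eq]
  intro x
  have hpos : (0 : ℝ) < (p : ℝ) ^ (-n : ℤ) :=
    zpow_pos (by exact_mod_cast (Fact.out : p.Prime).pos) _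
  filter_upwards [Metric.ball_mem_nhds x hpos] with y hy
  rw [← sub_eq_zero, ← map_sub, ← RingHom.mem_ker, PadicInt.ker_toZModPow,
    ← PadicInt.norm_le_pow_iff_mem_span_pow, ← dist_eq_norm]
  exact (Metric.mem_ball.1 hy).le

theorem isLocallyConstant_reduction (l : F → ℕ) :
    IsLocallyConstant (reduction l : (ZF F)ˣ → LevelUnits F l) := by
  rw [IsLocallyConstant.iff_eventually_eq]
  intro u
  have h : ∀ p : F, ∀ᶠ v in nhds u, reduction l v p = reduction l u p := fun p => by
    have hc : IsLocallyConstant fun v : (ZF F)ˣ =>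
        PadicInt.toZModPow (p := (p : Nat.Primes)) (l p) ((v : ZF F) p) :=
      (isLocallyConstant_toZModPow (l p)).comp_continuous
        ((continuous_apply p).comp Units.continuous_val)
    filter_upwards [(IsLocallyConstant.iff_eventually_eq _).1 hc u] with v hv
    exact Units.ext hv
  filter_upwards [Filter.eventually_all.2 h] with v hv
  exact funext hv

theorem unitOrder_eq_orderOf_reduction (hq : q ∉ F) (l : F → ℕ) :
    unitOrder hq l = orderOf (reduction l (isUnit_natCast_ZF hq).unit) := by
  rw [unitOrder]
  congr 1
  funext p
  apply Units.ext
  rw [coe_reduction, IsUnit.unit_spec, Pi.natCast_apply, map_natCast, ZMod.coe_unitOfCoprime]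

theorem unitOrder_dvd (hq : q ∉ F) {l : F → ℕ} (hl : ∀ p, 1 ≤ l p) : unitOrder hq l ∣
    ∏ p : F, (((p : Nat.Primes) : ℕ) - 1) * ((p : Nat.Primes) : ℕ) ^ (l p - 1) := by
  rw [unitOrder_eq_orderOf_reduction, ← card_levelUnits hl]
  exact orderOf_dvd_natCard _

/-- Congruence modulo every `p ^ (K p + k + 1)` forces equality. -/
theorem eq_of_reduction_eq {K : F → ℕ} {u v : (ZF F)ˣ}
    (h : ∀ k : ℕ, reduction (K + fun _ => k + 1) u = reduction (K + fun _ => k + 1) v) : u = v := by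
  refine Units.ext (funext fun p => PadicInt.ext_of_toZModPow.1 fun n => ?_)
  have := congr_arg Units.val (congr_fun (h n) p)
  rw [coe_reduction, coe_reduction] at this
  simp only [Pi.add_apply] at this
  have hn : n ≤ K p + (n + 1) := by omega
  rw [← PadicInt.cast_toZModPow _ _ hn, this, PadicInt.cast_toZModPow _ _ hn]

variable {K : F → ℕ} {d : ℕ}

theorem index_zpowers_reduction (hq : q ∉ F) (hK : ∀ p, 1 ≤ K p) (hd : 0 < d)
    (h : ∀ l : F → ℕ, unitOrder hq (K + l) = d * ∏ p : F, ((p : Nat.Primes) : ℕ) ^ l p)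
    (k : ℕ) :
    (Subgroup.zpowers (reduction (K + fun _ => k) (isUnit_natCast_ZF hq).unit)).index =
      (∏ p : F, (((p : Nat.Primes) : ℕ) - 1) * ((p : Nat.Primes) : ℕ) ^ (K p - 1)) / d := by
  have hcard := Subgroup.card_mul_index
    (Subgroup.zpowers (reduction (K + fun _ => k) (isUnit_natCast_ZF hq).unit))
  rw [Nat.card_zpowers, ← unitOrder_eq_orderOf_reduction hq, h,
    card_levelUnits (l := K + fun _ => k) fun p => (hK p).trans (Nat.le_add_right _ _)] at hcard
  have hsplit : ∏ p : F, (((p : Nat.Primes) : ℕ) - 1) *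
      ((p : Nat.Primes) : ℕ) ^ (K p + k - 1) =
      (∏ p : F, (((p : Nat.Primes) : ℕ) - 1) * ((p : Nat.Primes) : ℕ) ^ (K p - 1)) *
        ∏ p : F, ((p : Nat.Primes) : ℕ) ^ k := by
    rw [← Finset.prod_mul_distrib]
    refine Finset.prod_congr rfl fun p _ => ?_
    rw [mul_assoc, ← pow_add, Nat.sub_add_comm (hK p)]
  have hP : 0 < ∏ p : F, ((p : Nat.Primes) : ℕ) ^ k :=
    Finset.prod_pos fun p _ => pow_pos (p : Nat.Primes).2.pos _
  simp only [Pi.add_apply] at hcard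
  rw [hsplit, mul_right_comm] at hcard
  rw [← Nat.eq_of_mul_eq_mul_right hP hcard, Nat.mul_div_cancel_left _ hd]

/-- The subgroups generated by `q` have the same index at all levels `K + k`, so that membership in
them can be tested at level `K`. -/
theorem reduction_mem_zpowers (hq : q ∉ F) (hK : ∀ p, 1 ≤ K p) (hd : 0 < d)
    (h : ∀ l : F → ℕ, unitOrder hq (K + l) = d * ∏ p : F, ((p : Nat.Primes) : ℕ) ^ l p)
    {u : (ZF F)ˣ}
    (hu : reduction K u ∈ Subgroup.zpowers (reduction K (isUnit_natCast_ZF hq).unit)) (k : ℕ) :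
    reduction (K + fun _ => k) u ∈
      Subgroup.zpowers (reduction (K + fun _ => k) (isUnit_natCast_ZF hq).unit) := by
  have hle : K ≤ K + fun _ => k := fun p => Nat.le_add_right _ _
  set H := Subgroup.zpowers (reduction K (isUnit_natCast_ZF hq).unit) with hH
  set H' := Subgroup.zpowers (reduction (K + fun _ => k) (isUnit_natCast_ZF hq).unit) with hH'
  have hsub : H' ≤ H.comap (transition hle) := by
    rw [hH', Subgroup.zpowers_le, Subgroup.mem_comap, transition_reduction]
    exact Subgroup.mem_zpowers _
  have hindex : (H.comap (transition hle)).index = H'.index := by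
    rw [Subgroup.index_comap_of_surjective _ (transition_surjective hle hK),
      index_zpowers_reduction hq hK hd h k]
    exact index_zpowers_reduction hq hK hd h 0
  have hfin := finite_levelUnits (K + fun _ => k)
  have hrel := Subgroup.relIndex_mul_index hsub
  rw [hindex] at hrel
  have hone : H'.relIndex (H.comap (transition hle)) = 1 :=
    Nat.eq_of_mul_eq_mul_right (Nat.pos_of_ne_zero Subgroup.index_ne_zero_of_finite)
      (hrel.trans (one_mul _).symm)
  refine Subgroup.relIndex_eq_one.1 hone ?_
  rw [Subgroup.mem_comap, transition_reduction]
  exact hu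

/-- The radices `d P, P, P, …` with `P = ∏ p ∈ F, p`. Including `P` in the first one keeps it at
least `2` even when `d = 1`. -/
def radices (F : Finset Nat.Primes) (d : ℕ) : ℕ → ℕ
  | 0 => d * ∏ p : F, ((p : Nat.Primes) : ℕ)
  | _ + 1 => ∏ p : F, ((p : Nat.Primes) : ℕ)

theorem prod_radices_succ (F : Finset Nat.Primes) (d k : ℕ) :
    ∏ i ∈ Finset.range (k + 1), radices F d i =
      d * ∏ p : F, ((p : Nat.Primes) : ℕ) ^ (k + 1) := by
  rw [Finset.prod_range_succ']
  simp only [radices, Finset.prod_const, Finset.card_range, Finset.prod_pow]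
  ring

theorem two_le_radices (hF : F.Nonempty) (hd : 0 < d) (k : ℕ) : 2 ≤ radices F d k := by
  obtain ⟨p, hp⟩ := hF
  have hP : 2 ≤ ∏ p : F, ((p : Nat.Primes) : ℕ) :=
    p.2.two_le.trans <| Nat.le_of_dvd (Finset.prod_pos fun p _ => (p : Nat.Primes).2.pos)
      (Finset.dvd_prod_of_mem (fun p : F => ((p : Nat.Primes) : ℕ)) (Finset.mem_univ ⟨p, hp⟩))
  cases k with
  | zero => exact hP.trans (Nat.le_mul_of_pos_left _ hd)
  | succ k => exact hP

theorem supernaturalProd_radices (hd : 0 < d) :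
    supernaturalProd (radices F d) = mulPrimesInfty d F := by
  have hpow : ∀ (k : ℕ) (p : F), ((p : Nat.Primes) : ℕ) ^ k ≠ 0 := fun k p =>
    pow_ne_zero _ (p : Nat.Primes).2.ne_zero
  have hfac : ∀ (k : ℕ) (r : Nat.Primes),
      (∏ i ∈ Finset.range (k + 1), radices F d i).factorization r =
        d.factorization r + if r ∈ F then k + 1 else 0 := fun k r => by
    rw [prod_radices_succ, Nat.factorization_mul hd.ne'
      (Finset.prod_ne_zero_iff.2 fun p _ => hpow (k + 1) p), Finsupp.add_apply,
      Nat.factorization_prod_apply fun p _ => hpow (k + 1) p]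
    congr 1
    simp only [fun p : F => (p : Nat.Primes).2.factorization_pow (k := k + 1),
      Finsupp.single_apply]
    split_ifs with hr
    · exact (Finset.sum_eq_single (⟨r, hr⟩ : F) (fun p _ hp => if_neg fun h =>
        hp (Subtype.ext (Subtype.ext h))) (by simp)).trans (if_pos rfl)
    · exact Finset.sum_eq_zero fun p _ => if_neg fun h => hr (by
        rw [← show (p : Nat.Primes) = r from Subtype.ext h]; exact p.2)
  funext r
  rw [supernaturalProd, mulPrimesInfty]
  split_ifs with hr
  · rw [ENat.iSup_natCast_eq_top, not_bddAbove_iff]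
    intro b
    refine ⟨_, ⟨b + 1, rfl⟩, ?_⟩
    change b < (∏ i ∈ Finset.range (b + 1), radices F d i).factorization r
    rw [hfac, if_pos hr]
    omega
  · refine le_antisymm (iSup_le fun m => ?_) (le_iSup_of_le 1 ?_)
    · cases m with
      | zero => simp
      | succ k => rw [hfac, if_neg hr, add_zero]
    · rw [hfac, if_neg hr, add_zero]

/-- Multiplication by `q` on `𝒰(ℤ_F)` splits along the cosets of the closed subgroup generated by
`q`, and on each of them it is conjugate to the odometer. The coset of `u` is read off at level
`K`. After division by a coset representative, `u` is a power of `q` at each level `K + k`, and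
the exponent, a residue modulo `d P ^ k`, gives the odometer coordinate. -/
theorem exists_homeomorph_mulByPrime (hq : q ∉ F) (hK : ∀ p, 1 ≤ K p) (hd : 0 < d)
    (h : ∀ l : F → ℕ, unitOrder hq (K + l) = d * ∏ p : F, ((p : Nat.Primes) : ℕ) ^ l p) :
    ∃ e : (ZF F)ˣ ≃ₜ
        Fin ((∏ p : F, (((p : Nat.Primes) : ℕ) - 1) * ((p : Nat.Primes) : ℕ) ^ (K p - 1)) / d) ×
          ∀ k, Fin (radices F d k),
      ∀ u, e (mulByPrime hq u) = ((e u).1, odometer (radices F d) (e u).2) := by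
  set x : (ZF F)ˣ := (isUnit_natCast_ZF hq).unit
  have hT : ∀ u, mulByPrime hq u = x * u := fun u => rfl
  let H := Subgroup.zpowers (reduction K x)
  have hle : ∀ k, K ≤ K + fun _ => k := fun k p => Nat.le_add_right _ _
  have hle' : ∀ k, (K + fun _ => k) ≤ K + fun _ => k + 1 := fun k p =>
    Nat.add_le_add_left (Nat.le_succ k) _
  have hfin := finite_levelUnits K
  let eqv : LevelUnits F K ⧸ H ≃ Fin _ :=
    Finite.equivFinOfCardEq (index_zpowers_reduction hq hK hd h 0)
  let c : (ZF F)ˣ → Fin _ := fun u => eqv (QuotientGroup.mk (reduction K u))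
  have hcsurj : Function.Surjective c :=
    eqv.surjective.comp (QuotientGroup.mk_surjective.comp (reduction_surjective hK))
  choose rep hrep using hcsurj
  have hceq : ∀ u v, c u = c v ↔ reduction K (u⁻¹ * v) ∈ H := fun u v => by
    rw [eqv.apply_eq_iff_eq, QuotientGroup.eq, map_mul, map_inv]
  have hcx : ∀ u (m : ℤ), c (u * x ^ m) = c u := fun u m => by
    rw [eq_comm, hceq, inv_mul_cancel_left, map_zpow]
    exact ⟨m, rfl⟩
  have hlog : ∀ k u, ∃ m : ℤ, reduction (K + fun _ => k) x ^ m =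
      reduction (K + fun _ => k) ((rep (c u))⁻¹ * u) := fun k u =>
    reduction_mem_zpowers hq hK hd h ((hceq _ _).1 (hrep (c u))) k
  choose lg hlg using hlog
  -- Level `K` already has order `d`, while the empty product of radices is `1`; only the
  -- divisibility holds for `k = 0`.
  have hdvd : ∀ k, ∏ i ∈ Finset.range k, radices F d i ∣
      orderOf (reduction (K + fun _ => k) x) := fun k => by
    cases k with
    | zero => simp
    | succ k => rw [← unitOrder_eq_orderOf_reduction hq, h, prod_radices_succ]
  let a : ∀ k, (ZF F)ˣ → ZMod (∏ i ∈ Finset.range k, radices F d i) := fun k u => (lg k u : ℤ)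
  have ha : ∀ k u (m : ℤ), reduction (K + fun _ => k) x ^ m =
      reduction (K + fun _ => k) ((rep (c u))⁻¹ * u) → a k u = m := fun k u m hm => by
    rw [← hlg k u, zpow_eq_zpow_iff_modEq] at hm
    exact ((ZMod.intCast_eq_intCast_iff _ _ _).2
      (hm.of_dvd (Int.natCast_dvd_natCast.2 (hdvd k)))).symm
  have hcr : ∀ k u v, reduction (K + fun _ => k) u = reduction (K + fun _ => k) v → c u = c v :=
    fun k u v huv => by
      change eqv _ = eqv _
      rw [← transition_reduction (hle k), huv, transition_reduction]
  refine exists_homeomorph_prod_odometer (mulByPrime hq) (n := radices F d) (c := c) (a := a)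
    (fun k => ?_) ((isLocallyConstant_reduction K).comp fun g => eqv (QuotientGroup.mk g))
    (fun k => ?_) (fun u => ?_) (fun k u => ?_) (fun k u => ?_) (fun u v hc hav => ?_)
    fun i k m => ?_
  · have hP : 0 < ∏ p : F, ((p : Nat.Primes) : ℕ) :=
      Finset.prod_pos fun p _ => (p : Nat.Primes).2.pos
    cases k with
    | zero => exact mul_pos hd hP
    | succ k => exact hP
  · rw [IsLocallyConstant.iff_eventually_eq]
    intro u
    filter_upwards [(IsLocallyConstant.iff_eventually_eq _).1
      (isLocallyConstant_reduction (K + fun _ => k)) u] with v hv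
    refine ha k v (lg k u) ?_
    rw [hlg, hcr k v u hv, map_mul, map_mul, hv]
  · rw [hT, mul_comm]
    simpa using hcx u 1
  · have hcu : c (mulByPrime hq u) = c u := by
      rw [hT, mul_comm]
      simpa using hcx u 1
    have := ha k (mulByPrime hq u) (lg k u + 1) (by
      rw [zpow_add, hlg, zpow_one, hcu, hT, ← map_mul]
      congr 1
      rw [mul_comm x u, mul_assoc])
    rw [this]
    push_cast
    rfl
  · refine (ZMod.cast_intCast (Finset.prod_range_succ (radices F d) k ▸ dvd_mul_right _ _)
      (lg (k + 1) u)).trans (ha k u _ ?_).symm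
    have := congr_arg (transition (hle' k)) (hlg (k + 1) u)
    rwa [map_zpow, transition_reduction, transition_reduction] at this
  · refine eq_of_reduction_eq (K := K) fun k => ?_
    have hk : (lg (k + 1) u : ZMod (∏ i ∈ Finset.range (k + 1), radices F d i)) =
      lg (k + 1) v := hav (k + 1)
    have hord : ∏ i ∈ Finset.range (k + 1), radices F d i =
        orderOf (reduction (K + fun _ => k + 1) x) := by
      rw [← unitOrder_eq_orderOf_reduction hq, h, prod_radices_succ]
    rw [ZMod.intCast_eq_intCast_iff, hord, ← zpow_eq_zpow_iff_modEq, hlg, hlg, hc, map_mul,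
      map_mul] at hk
    exact mul_left_cancel hk
  · have hci : c (rep i * x ^ (m : ℤ)) = i := (hcx _ _).trans (hrep i)
    refine ⟨rep i * x ^ (m : ℤ), hci, ?_⟩
    rw [ha k _ m (by rw [hci, inv_mul_cancel_left, map_zpow]), Int.cast_natCast]

end Units

end CStarDynamics

end

/-- The constants are those of `exists_unitOrder_add_eq`, and the Bunce-Deddens algebra is the
crossed product by the odometer with radices `d P, P, P, …`. -/
theorem theorem3p1 (F : Finset Nat.Primes) (hF : F.Nonempty) (q : Nat.Primes) (hq : q ∉ F) :
    ∃ (K : F → ℕ) (d : ℕ),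
      (∀ p, 1 ≤ K p) ∧ 0 < d ∧
      (∀ l : F → ℕ, CStarDynamics.unitOrder hq (K + l) =
        d * ∏ p : F, ((p : Nat.Primes) : ℕ) ^ l p) ∧
      d ∣ ∏ p : F, (((p : Nat.Primes) : ℕ) - 1) * ((p : Nat.Primes) : ℕ) ^ (K p - 1) ∧
      ∃ (B : Type) (_ : CStarAlgebra B),
        CStarDynamics.IsBunceDeddens B (CStarDynamics.mulPrimesInfty d F) ∧
        Nonempty (CStarDynamics.HomeoCrossedProduct (CStarDynamics.mulByPrime hq) ≃⋆ₐ[ℂ]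
          (Fin ((∏ p : F, (((p : Nat.Primes) : ℕ) - 1) * ((p : Nat.Primes) : ℕ) ^ (K p - 1)) / d)
            → B)) := by
  obtain ⟨K, d, hK, hd, h⟩ := CStarDynamics.exists_unitOrder_add_eq hq
  refine ⟨K, d, hK, hd, h, ?_, ?_⟩
  · have hdvd := CStarDynamics.unitOrder_dvd hq hK
    rw [← add_zero K, h 0] at hdvd
    simpa using hdvd
  · obtain ⟨e, he⟩ := CStarDynamics.exists_homeomorph_mulByPrime hq hK hd h
    exact ⟨CStarDynamics.HomeoCrossedProduct
        (CStarDynamics.odometer (CStarDynamics.radices F d)), inferInstance,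
      ⟨CStarDynamics.radices F d, CStarDynamics.two_le_radices hF hd,
        CStarDynamics.supernaturalProd_radices hd, ⟨StarAlgEquiv.refl ℂ _⟩⟩,
      CStarDynamics.nonempty_crossedProduct_starAlgEquiv_pi e he⟩
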